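/- Let $l\ge 1$ and let $\mathfrak g(C_l^{(1)})=\mathfrak g\otimes\mathbb C[t,t^{-1}]\oplus\mathbb Cc\oplus\mathbb Cd$ be the untwisted affine Lie algebra attached to $\mathfrak g=\mathfrak{sp}(2l,\mathbb C)$ (for $l=1$ it is $A_1^{(1)}$), with Cartan subalgebra $\mathfrak h\oplus\mathbb Cc\oplus\mathbb Cd$, imaginary root $\delta$ and simple roots $\alpha_0=\delta-2\epsilon_1$, $\alpha_i=\epsilon_i-\epsilon_{i+1}$ $(0<i<l)$, $\alpha_l=2\epsilon_l$. For a sequence $s=(s_0,\dots,s_l)$ of positive integers and $j\geq 1$ let $\mathfrak g_j(s)$ be the sum of the root spaces of the roots $\sum_i k_i\alpha_i$ with $\sum_i k_is_i=j$, and put $$Q(s;C_l^{(1)})=\prod_{j\ge1}(1-q^j)^{\dim\mathfrak g_j(s)}\in\mathbb C[[q]].$$ Order the letters as $1,2,\dots,l,\bar l,\dots,\bar 2,\bar 1$, with weights $\mathrm{wt}(i)=\epsilon_i$ and $\mathrm{wt}(\bar\imath)=-\epsilon_i$. The array of root vectors for $C_l^{(1)}$ has as nodes the $pr\otimes t^n$,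 where $n\in\mathbb Z$ and $p,r$ are letters such that $r$ does not come after $p$; such a node has weight $\mathrm{wt}(p)+\mathrm{wt}(r)+n\delta$. The array of negative root vectors consists of the nodes whose weight is $-\sum_i k_i\alpha_i$ with integers $k_i\ge0$, not all zero. The $s$-specialized array $\mathcal N^{s}_{C_l^{(1)}}$ is obtained by giving such a node the label $\sum_i k_is_i$. (a) The array $\mathcal N^{(2,1,\dots,1,2)}_{C_l^{(1)}}$ (for $l=1$ the sequence is $(2,2)$) consists of $l-1$ copies of the positive integers, one copy of the even positive integers, and one copy of the positive integers congruent to $l+1$ modulo $2(l+1)$; that is, these together give the multiplicity with which each integer occurs as a label. Moreover, the spaces $\mathfrak g_j(2,1,\dots,1,2)$, $j\geq1$, are finite-dimensional, all infinite products below converge in $\mathbb C[[q]]$, and $$Q(2,1,\dots,1,2;C_l^{(1)})=\prod_{i\ge1}(1-q^i)^{l-1}\prod_{j\ge1}(1-q^{2j})\prod_{\substack{r\ge1\\ r\equiv l+1\ (\mathrm{mod}\ 2(l+1))}}(1-q^r).$$ (b) The array $\mathcal N^{(2,1,\dots,1)}_{C_l^{(1)}}$ consists of $l$ copies of the positive integers.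 Moreover, the spaces $\mathfrak g_j(2,1,\dots,1)$, $j\geq1$, are finite-dimensional, the infinite products converge, and $$Q(2,1,\dots,1;C_l^{(1)})=\prod_{i\ge1}(1-q^i)^l.$$ -/

import Mathlib

open scoped PowerSeries PowerSeries.WithPiTopology

noncomputable section

/-! ### Affinization of a Lie algebra -/

/-- An invariant symmetric bilinear form on a complex Lie algebra. -/
structure InvariantForm (𝔤 : Type*) [LieRing 𝔤] [LieAlgebra ℂ 𝔤] where
  /-- the bilinear form -/
  form : LinearMap.BilinForm ℂ 𝔤
  symm : ∀ x y, form x y = form y x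
  invariant : ∀ x y z, form ⁅x, y⁆ z = form x ⁅y, z⁆

namespace Loop

variable {𝔤 : Type*} [LieRing 𝔤] [LieAlgebra ℂ 𝔤]

/-- The bracket of the loop algebra `𝔤 ⊗ ℂ[t, t⁻¹]`, whose elements `∑ xₙ ⊗ tⁿ` are written as
finitely supported functions `ℤ →₀ 𝔤`: `[x ⊗ tᵐ, y ⊗ tⁿ] = [x, y] ⊗ tᵐ⁺ⁿ`. -/
def bracket : (ℤ →₀ 𝔤) →ₗ[ℂ] (ℤ →₀ 𝔤) →ₗ[ℂ] (ℤ →₀ 𝔤) :=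
  Finsupp.lsum ℂ fun m => LinearMap.flip <| Finsupp.lsum ℂ fun n => LinearMap.flip <|
    (LieModule.toEnd ℂ 𝔤 𝔤 : 𝔤 →ₗ[ℂ] 𝔤 →ₗ[ℂ] 𝔤).compr₂ (Finsupp.lsingle (m + n))

@[simp] theorem bracket_single (m n : ℤ) (x y : 𝔤) :
    bracket (Finsupp.single m x) (Finsupp.single n y) = Finsupp.single (m + n) ⁅x, y⁆ := by
  simp [bracket]

/-- The operator `t d/dt` on the loop algebra: `x ⊗ tⁿ ↦ n x ⊗ tⁿ`. -/
def euler : (ℤ →₀ 𝔤) →ₗ[ℂ] (ℤ →₀ 𝔤) :=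
  Finsupp.lsum ℂ fun n => (n : ℂ) • Finsupp.lsingle n

@[simp] theorem euler_single (n : ℤ) (x : 𝔤) :
    euler (Finsupp.single n x) = (n : ℂ) • Finsupp.single n x := by
  simp [euler]

/-- The bilinear form `(x ⊗ tᵐ, y ⊗ tⁿ) ↦ m δ_{m+n,0} ⟨x, y⟩` on the loop algebra. -/
def cocycle (B : InvariantForm 𝔤) : (ℤ →₀ 𝔤) →ₗ[ℂ] (ℤ →₀ 𝔤) →ₗ[ℂ] ℂ :=
  Finsupp.lsum ℂ fun m => LinearMap.flip <| Finsupp.lsum ℂ fun n => LinearMap.flip <|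
    (if m + n = 0 then (m : ℂ) else 0) • B.form

@[simp] theorem cocycle_single (B : InvariantForm 𝔤) (m n : ℤ) (x y : 𝔤) :
    cocycle B (Finsupp.single m x) (Finsupp.single n y) =
      (if m + n = 0 then (m : ℂ) else 0) * B.form x y := by
  simp only [cocycle, Finsupp.lsum_apply, LinearMap.flip_apply, Finsupp.sum_single_index,
    map_zero, LinearMap.smul_apply, smul_eq_mul]

theorem bracket_skew (f g : ℤ →₀ 𝔤) : bracket f g = - bracket g f := by
  induction f using Finsupp.induction_linear with
  | zero => simp
  | add f₁ f₂ h₁ h₂ => simp only [map_add, LinearMap.add_apply, h₁, h₂, neg_add]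
  | single m x =>
    induction g using Finsupp.induction_linear with
    | zero => simp
    | add g₁ g₂ h₁ h₂ => simp only [map_add, LinearMap.add_apply, h₁, h₂, neg_add]
    | single n y =>
      rw [bracket_single, bracket_single, ← lie_skew, Finsupp.single_neg, add_comm]

theorem bracket_self (f : ℤ →₀ 𝔤) : bracket f f = 0 := by
  have h : (2 : ℂ) • bracket f f = 0 := by
    rw [two_smul]; exact eq_neg_iff_add_eq_zero.mp (bracket_skew f f)
  exact (smul_eq_zero.mp h).resolve_left two_ne_zero

theorem bracket_jacobi (f g h : ℤ →₀ 𝔤) :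
    bracket f (bracket g h) = bracket (bracket f g) h + bracket g (bracket f h) := by
  induction f using Finsupp.induction_linear with
  | zero => simp
  | add f₁ f₂ h₁ h₂ => simp only [map_add, LinearMap.add_apply, h₁, h₂]; abel
  | single m x =>
    induction g using Finsupp.induction_linear with
    | zero => simp
    | add g₁ g₂ h₁ h₂ => simp only [map_add, LinearMap.add_apply, h₁, h₂]; abel
    | single n y =>
      induction h using Finsupp.induction_linear with
      | zero => simp
      | add g₁ g₂ h₁ h₂ => simp only [map_add, h₁, h₂]; abel
      | single p z =>
        simp only [bracket_single]
        rw [leibniz_lie, Finsupp.single_add, add_assoc, add_left_comm n m p]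

theorem euler_bracket (f g : ℤ →₀ 𝔤) :
    euler (bracket f g) = bracket (euler f) g + bracket f (euler g) := by
  induction f using Finsupp.induction_linear with
  | zero => simp
  | add f₁ f₂ h₁ h₂ => simp only [map_add, LinearMap.add_apply, h₁, h₂]; abel
  | single m x =>
    induction g using Finsupp.induction_linear with
    | zero => simp
    | add g₁ g₂ h₁ h₂ => simp only [map_add, h₁, h₂]; abel
    | single n y =>
      simp only [bracket_single, euler_single, map_smul, LinearMap.smul_apply, Int.cast_add,
        add_smul]

theorem cocycle_skew (B : InvariantForm 𝔤) (f g : ℤ →₀ 𝔤) :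
    cocycle B f g = - cocycle B g f := by
  induction f using Finsupp.induction_linear with
  | zero => simp
  | add f₁ f₂ h₁ h₂ => simp only [map_add, LinearMap.add_apply, h₁, h₂, neg_add]
  | single m x =>
    induction g using Finsupp.induction_linear with
    | zero => simp
    | add g₁ g₂ h₁ h₂ => simp only [map_add, LinearMap.add_apply, h₁, h₂, neg_add]
    | single n y =>
      rw [cocycle_single, cocycle_single, B.symm y x, add_comm n m]
      split_ifs with h
      · have : (n : ℂ) = -m := by rw [eq_neg_iff_add_eq_zero, add_comm]; exact_mod_cast h
        rw [this]; ring
      · ring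

theorem cocycle_jacobi (B : InvariantForm 𝔤) (f g h : ℤ →₀ 𝔤) :
    cocycle B f (bracket g h) = cocycle B (bracket f g) h + cocycle B g (bracket f h) := by
  induction f using Finsupp.induction_linear with
  | zero => simp
  | add f₁ f₂ h₁ h₂ => simp only [map_add, LinearMap.add_apply, h₁, h₂]; abel
  | single m x =>
    induction g using Finsupp.induction_linear with
    | zero => simp
    | add g₁ g₂ h₁ h₂ => simp only [map_add, LinearMap.add_apply, h₁, h₂]; abel
    | single n y =>
      induction h using Finsupp.induction_linear with
      | zero => simp
      | add g₁ g₂ h₁ h₂ => simp only [map_add, h₁, h₂]; abel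
      | single p z =>
        have e : B.form y ⁅x, z⁆ = - B.form x ⁅y, z⁆ := by
          rw [← B.invariant, ← B.invariant, ← lie_skew, map_neg, LinearMap.neg_apply]
        simp only [bracket_single, cocycle_single, e, B.invariant x y z, ← add_assoc,
          add_comm n m]
        split_ifs
        · push_cast; ring
        · ring

theorem cocycle_euler (B : InvariantForm 𝔤) (f g : ℤ →₀ 𝔤) :
    cocycle B (euler f) g + cocycle B f (euler g) = 0 := by
  induction f using Finsupp.induction_linear with
  | zero => simp
  | add f₁ f₂ h₁ h₂ =>
    simp only [map_add, LinearMap.add_apply]; linear_combination h₁ + h₂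
  | single m x =>
    induction g using Finsupp.induction_linear with
    | zero => simp
    | add g₁ g₂ h₁ h₂ => simp only [map_add]; linear_combination h₁ + h₂
    | single n y =>
      simp only [cocycle_single, euler_single, map_smul, LinearMap.smul_apply, smul_eq_mul]
      split_ifs with h
      · have : (n : ℂ) = -m := by rw [eq_neg_iff_add_eq_zero, add_comm]; exact_mod_cast h
        rw [this]; ring
      · ring

end Loop

/-- The affine Lie algebra `𝔤 ⊗ ℂ[t, t⁻¹] ⊕ ℂ c ⊕ ℂ d` attached to a Lie algebra `𝔤` with an
invariant symmetric form. -/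
@[ext] structure Affinization {𝔤 : Type*} [LieRing 𝔤] [LieAlgebra ℂ 𝔤] (B : InvariantForm 𝔤) where
  /-- the component in the loop algebra -/
  loop : ℤ →₀ 𝔤
  /-- the coefficient of the central element `c` -/
  cen : ℂ
  /-- the coefficient of the derivation `d` -/
  der : ℂ

namespace Affinization

variable {𝔤 : Type*} [LieRing 𝔤] [LieAlgebra ℂ 𝔤] {B : InvariantForm 𝔤}

/-- As a set, the affine Lie algebra is a product. -/
def toProd : Affinization B ≃ (ℤ →₀ 𝔤) × ℂ × ℂ where
  toFun x := (x.loop, x.cen, x.der)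
  invFun p := ⟨p.1, p.2.1, p.2.2⟩
  left_inv _ := rfl
  right_inv _ := rfl

instance : AddCommGroup (Affinization B) := toProd.addCommGroup

instance : Module ℂ (Affinization B) := toProd.module ℂ

/-- The bracket determined by `[x(m), y(n)] = [x, y](m + n) + m δ_{m+n,0} ⟨x, y⟩ c`, by
`[d, x(n)] = n x(n)` and by `c` being central, where `x(n) = x ⊗ tⁿ`. -/
instance : Bracket (Affinization B) (Affinization B) where
  bracket u v :=
    ⟨Loop.bracket u.loop v.loop + u.der • Loop.euler v.loop - v.der • Loop.euler u.loop,
      Loop.cocycle B u.loop v.loop, 0⟩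

@[simp] theorem add_loop (u v : Affinization B) : (u + v).loop = u.loop + v.loop := rfl
@[simp] theorem add_cen (u v : Affinization B) : (u + v).cen = u.cen + v.cen := rfl
@[simp] theorem add_der (u v : Affinization B) : (u + v).der = u.der + v.der := rfl
@[simp] theorem zero_loop : (0 : Affinization B).loop = 0 := rfl
@[simp] theorem zero_cen : (0 : Affinization B).cen = 0 := rfl
@[simp] theorem zero_der : (0 : Affinization B).der = 0 := rfl
@[simp] theorem smul_loop (a : ℂ) (u : Affinization B) : (a • u).loop = a • u.loop := rfl
@[simp] theorem smul_cen (a : ℂ) (u : Affinization B) : (a • u).cen = a * u.cen := rfl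
@[simp] theorem smul_der (a : ℂ) (u : Affinization B) : (a • u).der = a * u.der := rfl
@[simp] theorem lie_loop (u v : Affinization B) : ⁅u, v⁆.loop =
    Loop.bracket u.loop v.loop + u.der • Loop.euler v.loop - v.der • Loop.euler u.loop := rfl
@[simp] theorem lie_cen (u v : Affinization B) : ⁅u, v⁆.cen = Loop.cocycle B u.loop v.loop := rfl
@[simp] theorem lie_der (u v : Affinization B) : ⁅u, v⁆.der = 0 := rfl

instance : LieRing (Affinization B) where
  add_lie u v w := by
    ext1
    · simp only [lie_loop, add_loop, add_der, map_add, LinearMap.add_apply]; module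
    · simp
    · simp
  lie_add u v w := by
    ext1
    · simp only [lie_loop, add_loop, add_der, map_add]; module
    · simp
    · simp
  lie_self u := by
    ext1
    · simp [Loop.bracket_self]
    · exact CharZero.eq_neg_self_iff.mp (Loop.cocycle_skew B u.loop u.loop)
    · simp
  leibniz_lie u v w := by
    ext1
    · simp only [lie_loop, lie_der, add_loop, map_add, map_sub, map_smul, LinearMap.add_apply,
        LinearMap.sub_apply, LinearMap.smul_apply, Loop.euler_bracket,
        Loop.bracket_jacobi u.loop v.loop, Loop.bracket_skew v.loop (Loop.euler u.loop)]
      module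
    · have h₁ := Loop.cocycle_euler B v.loop w.loop
      have h₂ := Loop.cocycle_euler B u.loop w.loop
      have h₃ := Loop.cocycle_euler B u.loop v.loop
      have h₄ := Loop.cocycle_skew B v.loop (Loop.euler u.loop)
      simp only [lie_loop, lie_cen, add_cen, map_add, map_sub, map_smul, LinearMap.add_apply,
        LinearMap.sub_apply, LinearMap.smul_apply, smul_eq_mul,
        Loop.cocycle_jacobi B u.loop v.loop]
      linear_combination (-u.der) * h₁ + v.der * h₂ - w.der * h₃ + w.der * h₄
    · simp

instance : LieAlgebra ℂ (Affinization B) where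
  lie_smul a u v := by
    ext1
    · simp only [lie_loop, smul_loop, smul_der, map_smul]; module
    · simp
    · simp

end Affinization

/-! ### The affine Lie algebra of type `C_l^{(1)}` -/

namespace AffineC

/-- The form `⟨x, y⟩ = tr (x y)` on the simple Lie algebra `sp(2l, ℂ)` of type `C_l`; its long
roots have square length `2`. -/
def traceForm (l : ℕ) : InvariantForm (LieAlgebra.Symplectic.sp (Fin l) ℂ) where
  form := LinearMap.mk₂ ℂ (fun x y => Matrix.trace (x.1 * y.1))
    (by intro x y z; simp [add_mul]) (by intro c x y; simp)
    (by intro x y z; simp [mul_add]) (by intro c x y; simp)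
  symm x y := Matrix.trace_mul_comm x.1 y.1
  invariant x y z := by
    simp only [LinearMap.mk₂_apply, LieSubalgebra.coe_bracket, Ring.lie_def, sub_mul, mul_sub,
      Matrix.trace_sub, ← mul_assoc]
    rw [Matrix.trace_mul_cycle x.1 z.1 y.1]

/-- The affine Lie algebra `𝔤(C_l^{(1)})`. -/
abbrev Alg (l : ℕ) : Type := Affinization (traceForm l)

/-- Coordinates on the Cartan subalgebra `𝔥 ⊕ ℂ c ⊕ ℂ d`, where `𝔥` is the space of diagonal
matrices `diag(h₁, …, h_l, -h₁, …, -h_l)`. -/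
abbrev Cartan (l : ℕ) : Type := (Fin l → ℂ) × ℂ × ℂ

/-- The matrix `diag(h₁, …, h_l, -h₁, …, -h_l)` of `sp(2l, ℂ)`. -/
def diag (l : ℕ) (h : Fin l → ℂ) : LieAlgebra.Symplectic.sp (Fin l) ℂ :=
  ⟨Matrix.diagonal (Sum.elim h (-h)), by
    change _ ∈ skewAdjointMatricesSubmodule _
    simp only [mem_skewAdjointMatricesSubmodule, Matrix.IsSkewAdjoint, Matrix.IsAdjointPair]
    ext i j
    rcases i with i | i <;> rcases j with j | j <;>
      simp [Matrix.J, Matrix.diagonal_mul, Matrix.mul_diagonal, Matrix.one_apply] <;>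
      grind⟩

/-- The inclusion of the Cartan subalgebra: `(h, a, b) ↦ diag(h, -h) ⊗ t⁰ + a c + b d`. -/
def cartanIncl (l : ℕ) (H : Cartan l) : Alg l :=
  ⟨Finsupp.single 0 (diag l H.1), H.2.1, H.2.2⟩

/-- The space of weights, the dual of the Cartan subalgebra. -/
abbrev Weight (l : ℕ) : Type := Module.Dual ℂ (Cartan l)

/-- The weight `ε_{i+1}`, for `i = 0, …, l - 1`. -/
def eps (l : ℕ) (i : Fin l) : Weight l :=
  (LinearMap.proj i).comp (LinearMap.fst ℂ (Fin l → ℂ) (ℂ × ℂ))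

/-- The imaginary root `δ`: it vanishes on `𝔥` and on `c`, and `δ(d) = 1`. -/
def delta (l : ℕ) : Weight l :=
  (LinearMap.snd ℂ ℂ ℂ).comp (LinearMap.snd ℂ (Fin l → ℂ) (ℂ × ℂ))

/-- The weight `ε_k` for `1 ≤ k ≤ l` (and `0` for other `k`). -/
def epsN (l k : ℕ) : Weight l :=
  if h : 1 ≤ k ∧ k ≤ l then eps l ⟨k - 1, by omega⟩ else 0

/-- The simple roots of `C_l^{(1)}`: `α₀ = δ - 2ε₁`, `α_i = ε_i - ε_{i+1}` for `0 < i < l`, and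
`α_l = 2ε_l`. -/
def simpleRoot (l : ℕ) (i : Fin (l + 1)) : Weight l :=
  if i.1 = 0 then delta l - 2 • epsN l 1
  else if i.1 = l then 2 • epsN l l
  else epsN l i.1 - epsN l (i.1 + 1)

/-- The weight space of weight `α` of `𝔤(C_l^{(1)})`. -/
def rootSpace (l : ℕ) (α : Weight l) : Submodule ℂ (Alg l) :=
  ⨅ H : Cartan l, (LieAlgebra.ad ℂ (Alg l) (cartanIncl l H)).eigenspace (α H)

/-- The set `Δ` of roots of `𝔤(C_l^{(1)})`. -/
def roots (l : ℕ) : Set (Weight l) := {α | α ≠ 0 ∧ rootSpace l α ≠ ⊥}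

/-- The set `Δ_{j,s}` of roots `∑ k_i α_i` with `∑ k_i s_i = j`. -/
def rootsOfDegree (l : ℕ) (s : Fin (l + 1) → ℕ) (j : ℤ) : Set (Weight l) :=
  {α | α ∈ roots l ∧ ∃ k : Fin (l + 1) → ℤ,
    α = ∑ i, k i • simpleRoot l i ∧ ∑ i, k i * (s i : ℤ) = j}

/-- The piece `𝔤_j(s; C_l^{(1)})` of degree `j` of the `s`-gradation, for `j ≠ 0`: the sum of the
root spaces of the roots in `Δ_{j,s}`. -/
def gradedPiece (l : ℕ) (s : Fin (l + 1) → ℕ) (j : ℤ) : Submodule ℂ (Alg l) :=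
  ⨆ α ∈ rootsOfDegree l s j, rootSpace l α

/-- The factor `(1 - q^j)^{dim 𝔤_j(s; C_l^{(1)})}` of the specialized denominator. -/
def denominatorFactor (l : ℕ) (s : Fin (l + 1) → ℕ) (j : ℕ+) : ℂ⟦X⟧ :=
  (1 - PowerSeries.X ^ (j : ℕ)) ^ Module.finrank ℂ (gradedPiece l s (j : ℤ))

/-- The `s`-specialized denominator
`Q(s; C_l^{(1)}) = ∏_{j ≥ 1} (1 - q^j)^{dim 𝔤_j(s; C_l^{(1)})}` of the Weyl-Kac character formula,
where infinite products in `ℂ⟦q⟧` are taken coefficientwise. -/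
def Q (l : ℕ) (s : Fin (l + 1) → ℕ) : ℂ⟦X⟧ := ∏' j : ℕ+, denominatorFactor l s j

/-! ### The array of negative root vectors -/

/-- The vertices `1 → 2 → ⋯ → l → l̄ → ⋯ → 2̄ → 1̄` of the crystal of the vector representation of
`C_l`; here `inl i` stands for `i + 1` and `inr i` for its barred version. -/
abbrev Letter (l : ℕ) : Type := Fin l ⊕ Fin l

/-- The weights of the vector representation: `ε_i` for `i` and `-ε_i` for `ī`. -/
def Letter.wt {l : ℕ} : Letter l → Weight l
  | .inl i => eps l i
  | .inr i => -eps l i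

/-- The position of a letter in the crystal of the vector representation, counted from `0`. -/
def Letter.pos {l : ℕ} : Letter l → ℕ
  | .inl i => i.1
  | .inr i => 2 * l - 1 - i.1

/-- The array of root vectors for `C_l^{(1)}`. Its nodes are the elements `pr ⊗ tⁿ` with `n ∈ ℤ`
and `pr` in the crystal of the adjoint representation, the triangle of pairs of letters (column
`p`, row `r`) in which the position of `r` is at most that of `p`. -/
structure Node (l : ℕ) where
  /-- the column -/
  col : Letter l
  /-- the row -/
  row : Letter l
  /-- the power of `t` -/
  power : ℤ
  row_le_col : row.pos ≤ col.pos

/-- The weight of `pr ⊗ tⁿ`, namely `wt p + wt r + n δ`. -/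
def Node.wt {l : ℕ} (v : Node l) : Weight l := v.col.wt + v.row.wt + v.power • delta l

/-- `k` lists the coefficients of a nonzero sum `∑ k_i α_i`, `k_i ≥ 0`, which is minus the weight
of `v`. -/
def Node.IsNegCoeffs {l : ℕ} (v : Node l) (k : Fin (l + 1) → ℕ) : Prop :=
  k ≠ 0 ∧ v.wt = -∑ i, k i • simpleRoot l i

/-- The nodes of the array of negative root vectors for `C_l^{(1)}`. -/
def NegNode (l : ℕ) : Type := {v : Node l // ∃ k, v.IsNegCoeffs k}

theorem simpleRoot_apply_der (l : ℕ) (i : Fin (l + 1)) :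
    simpleRoot l i (0, 0, 1) = if i.1 = 0 then 1 else 0 := by
  unfold simpleRoot epsN
  split_ifs <;> simp [delta, eps]

theorem simpleRoot_apply_single (l : ℕ) (i : Fin (l + 1)) (j : Fin l) :
    simpleRoot l i (Pi.single j 1, 0, 0) =
      if i.1 = j.1 + 1 then (if i.1 = l then 2 else 1)
      else if i.1 = j.1 then (if i.1 = 0 then -2 else -1) else 0 := by
  have hj := j.2
  have key : ∀ k : ℕ, epsN l k (Pi.single j 1, 0, 0) = if k = j.1 + 1 then 1 else 0 := by
    intro k
    unfold epsN
    split_ifs with h₁ h₂ h₂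
    · have : (⟨k - 1, by omega⟩ : Fin l) = j := Fin.ext (by simp; omega)
      simp [eps, this]
    · have : (⟨k - 1, by omega⟩ : Fin l) ≠ j := fun e => by
        have := congrArg Fin.val e; simp at this; omega
      simp [eps, this]
    · omega
    · simp
  have hd : delta l (Pi.single j 1, 0, 0) = 0 := by simp [delta]
  unfold simpleRoot
  split_ifs <;> simp only [LinearMap.sub_apply, LinearMap.smul_apply, key, hd] <;>
    split_ifs <;> first | omega | simp

/-- The simple roots are linearly independent, so labels are well defined. -/
theorem simpleRoot_coeffs_unique (l : ℕ) (k k' : Fin (l + 1) → ℕ)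
    (h : ∑ i, k i • simpleRoot l i = ∑ i, k' i • simpleRoot l i) : k = k' := by
  have ev : ∀ H : Cartan l, ∑ i, (k i : ℂ) * simpleRoot l i H =
      ∑ i, (k' i : ℂ) * simpleRoot l i H := by
    intro H
    have := congrArg (fun φ : Weight l => φ H) h
    simpa [LinearMap.sum_apply] using this
  have main : ∀ (n : ℕ) (hn : n < l + 1), k ⟨n, hn⟩ = k' ⟨n, hn⟩ := by
    intro n
    induction n with
    | zero =>
      intro hn
      have := ev (0, 0, 1)
      simp only [simpleRoot_apply_der] at this
      rw [Finset.sum_eq_single ⟨0, hn⟩, Finset.sum_eq_single ⟨0, hn⟩] at this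
      · rw [if_pos rfl, mul_one, mul_one] at this
        exact_mod_cast this
      · intro i _ hi
        rw [if_neg (fun e => hi (Fin.ext e)), mul_zero]
      · exact fun hi => absurd (Finset.mem_univ _) hi
      · intro i _ hi
        rw [if_neg (fun e => hi (Fin.ext e)), mul_zero]
      · exact fun hi => absurd (Finset.mem_univ _) hi
    | succ n ih =>
      intro hn
      have e := ev (Pi.single ⟨n, by omega⟩ 1, 0, 0)
      have e' : ∑ i, ((k i : ℂ) - k' i) * simpleRoot l i (Pi.single ⟨n, by omega⟩ 1, 0, 0) = 0 := by
        simp only [sub_mul, Finset.sum_sub_distrib, e, sub_self]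
      rw [Finset.sum_eq_single ⟨n + 1, hn⟩] at e'
      · rw [simpleRoot_apply_single] at e'
        have : ((k ⟨n + 1, hn⟩ : ℂ) - k' ⟨n + 1, hn⟩) = 0 := by
          rcases mul_eq_zero.mp e' with h | h
          · exact h
          · exfalso
            revert h
            simp only [if_true]
            split_ifs <;> norm_num
        exact_mod_cast sub_eq_zero.mp this
      · intro i _ hi
        rw [simpleRoot_apply_single, if_neg (fun e => hi (Fin.ext e))]
        split_ifs with h₁ h₂
        · have := ih (by omega)
          have hi' : i = ⟨n, by omega⟩ := Fin.ext h₁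
          rw [hi', this]; simp
        · have := ih (by omega)
          have hi' : i = ⟨n, by omega⟩ := Fin.ext h₁
          rw [hi', this]; simp
        · simp
      · simp
  exact funext fun i => main i.1 i.2

/-- The `s`-specialized weighted array for `C_l^{(1)}`: the label of a node of weight `-∑ k_i α_i`
is `∑ k_i s_i`. So the Chevalley generator `f_i` has label `s_i`, and labels increase by `s_i`
along `i`-arrows. -/
def specializedArray (l : ℕ) (s : Fin (l + 1) → ℕ) (v : NegNode l) : ℕ :=
  ∑ i, v.2.choose i * s i

theorem specializedArray_eq (l : ℕ) (s : Fin (l + 1) → ℕ) (v : NegNode l) (k : Fin (l + 1) → ℕ)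
    (h : v.1.wt = -∑ i, k i • simpleRoot l i) : specializedArray l s v = ∑ i, k i * s i := by
  have : v.2.choose = k :=
    simpleRoot_coeffs_unique l _ _ (neg_injective (v.2.choose_spec.2.symm.trans h))
  simp only [specializedArray, this]

/-- The number of nodes with label `m` in the `s`-specialized weighted array. -/
def multiplicity (l : ℕ) (s : Fin (l + 1) → ℕ) (m : ℕ) : ℕ∞ :=
  {v : NegNode l | specializedArray l s v = m}.encard

/-- The sequence `(2, 1, …, 1, 2)`. -/
def seq212 (l : ℕ) (i : Fin (l + 1)) : ℕ := if i.1 = 0 ∨ i.1 = l then 2 else 1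

/-- The sequence `(2, 1, …, 1)`. -/
def seq21 (l : ℕ) (i : Fin (l + 1)) : ℕ := if i.1 = 0 then 2 else 1

end AffineC

end

noncomputable section

namespace Affinization

variable {𝔤 : Type*} [LieRing 𝔤] [LieAlgebra ℂ 𝔤] {B : InvariantForm 𝔤}

/-! Both sequences are `(2, 1, …, 1, N - 2l)`, with `N = 2l + 2` or `N = 2l + 1`. They are the
values of the simple roots at the Cartan element where `ε_i` is `N/2 - i` and `δ` is `N`
(`simpleRoot_grading`). Give `i` the residue `i` and `ī` the residue `N - i`. Then `pr ⊗ tⁿ` has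
degree `N(n + 1)` minus the two residues (`Node.wt_grading`).

So a node of degree `e` is an unordered pair of residues with sum `≡ -e (mod N)`; the pair
determines `n`. For `N = 2l + 1` the residues are all nonzero classes, and each sum is attained by
`l` pairs. For `N = 2l + 2` the class `l + 1` is missing as well, which leaves `l - 1` pairs, one
more for an even sum, and one more for the sum `l + 1`, where the two forbidden classes form a
single pair (`encard_degree_odd_period`, `encard_degree_even_period`).

This count serves both halves. Root vectors of nodes form a basis of each graded piece
(`gradedPiece_eq_span`), and nodes of degree `-m < 0` are exactly those with label `m`
(`multiplicity_eq`). The product formulas follow by comparing exponents. -/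

theorem sub_cen (u v : Affinization B) : (u - v).cen = u.cen - v.cen := rfl

theorem sub_der (u v : Affinization B) : (u - v).der = u.der - v.der := rfl

end Affinization

namespace AffineC

variable {l : ℕ}

instance : DecidableEq (Node l) := Classical.decEq _

/-! ### Root vectors and root spaces -/

/-- The sign of a letter in the symplectic form: `1` for `i` and `-1` for `ī`. -/
def Letter.sign : Letter l → ℂ
  | .inl _ => 1
  | .inr _ => -1

theorem Letter.sign_mul_self (p : Letter l) : p.sign * p.sign = 1 := by
  rcases p with i | i <;> simp [Letter.sign]

/-- In the entries `X a b̄`, skew-adjointness is symmetry up to sign: the identification of `sp(2l)`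
with `Sym² V`, which is why a triangle of pairs of letters indexes a basis. -/
theorem mem_sp_iff (X : Matrix (Letter l) (Letter l) ℂ) :
    X ∈ LieAlgebra.Symplectic.sp (Fin l) ℂ ↔
      ∀ a b : Letter l, X a b.swap = a.sign * b.sign * X b a.swap := by
  change X ∈ skewAdjointMatricesSubmodule _ ↔ _
  simp only [mem_skewAdjointMatricesSubmodule, Matrix.IsSkewAdjoint, Matrix.IsAdjointPair]
  rw [← Matrix.ext_iff]
  simp only [Sum.forall, Letter.sign, Sum.swap_inl, Sum.swap_inr, Matrix.mul_apply,
    Fintype.sum_sum_type, Matrix.J, Matrix.transpose_apply, Matrix.fromBlocks_apply₁₁,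
    Matrix.fromBlocks_apply₁₂, Matrix.fromBlocks_apply₂₁, Matrix.fromBlocks_apply₂₂,
    Matrix.zero_apply, Matrix.neg_apply, Matrix.one_apply, mul_zero, zero_mul,
    Finset.sum_const_zero, zero_add, add_zero, mul_neg, neg_mul, neg_neg, mul_ite, ite_mul, mul_one,
    one_mul, Finset.sum_neg_distrib, Finset.sum_ite_eq, Finset.sum_ite_eq', Finset.mem_univ,
    if_true, forall_and]
  constructor
  · rintro ⟨⟨h₁, h₂⟩, h₃, h₄⟩
    refine ⟨⟨?_, ?_⟩, ?_, ?_⟩ <;> intros <;> grind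
  · rintro ⟨⟨h₁, h₂⟩, h₃, h₄⟩
    refine ⟨⟨?_, ?_⟩, ?_, ?_⟩ <;> intros <;> grind

theorem Letter.pos_injective : Function.Injective (Letter.pos (l := l)) := by
  rintro (i | i) (j | j) h <;> simp only [Letter.pos] at h
  · exact congrArg _ (Fin.ext h)
  · omega
  · omega
  · exact congrArg _ (Fin.ext (by omega))

theorem lie_cartanIncl_entry (H : Cartan l) (u : Alg l) (n : ℤ) (p q : Letter l) :
    ((⁅cartanIncl l H, u⁆ : Alg l).loop n).1 p q =
      (p.wt H - q.wt H + n * H.2.2) * (u.loop n).1 p q := by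
  have hdiag : ∀ a : Letter l, Sum.elim H.1 (-H.1) a = a.wt H := by
    rintro (a | a) <;> simp [Letter.wt, eps]
  have h₁ : ∀ f : ℤ →₀ LieAlgebra.Symplectic.sp (Fin l) ℂ,
      (Loop.bracket (Finsupp.single 0 (diag l H.1)) f n).1 p q =
        (p.wt H - q.wt H) * (f n).1 p q := by
    intro f
    induction f using Finsupp.induction_linear with
    | zero => simp
    | add f g hf hg =>
      simp only [map_add, Finsupp.add_apply, AddMemClass.coe_add, Matrix.add_apply, hf, hg]
      ring
    | single m x =>
      rw [Loop.bracket_single, zero_add, Finsupp.single_apply, Finsupp.single_apply]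
      split_ifs
      · simp only [LieSubalgebra.coe_bracket, Ring.lie_def, Matrix.sub_apply, diag,
          Matrix.diagonal_mul, Matrix.mul_diagonal, hdiag]
        ring
      · simp
  have h₂ : ∀ f : ℤ →₀ LieAlgebra.Symplectic.sp (Fin l) ℂ,
      Loop.euler f n = (n : ℂ) • f n := by
    intro f
    induction f using Finsupp.induction_linear with
    | zero => simp
    | add f g hf hg => simp only [map_add, Finsupp.add_apply, hf, hg, smul_add]
    | single m x =>
      rw [Loop.euler_single, Finsupp.smul_apply, Finsupp.single_apply]
      split_ifs with h
      · rw [h]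
      · simp
  have h₃ : Loop.euler (cartanIncl l H).loop = 0 := by simp [cartanIncl]
  rw [Affinization.lie_loop, h₃, smul_zero, sub_zero, Finsupp.add_apply, Finsupp.smul_apply, h₂,
    AddMemClass.coe_add, Matrix.add_apply]
  have h₄ := h₁ u.loop
  simp only [cartanIncl, SetLike.val_smul, Matrix.smul_apply, smul_eq_mul] at h₄ ⊢
  rw [h₄]
  ring

theorem mem_rootSpace_iff {α : Weight l} {u : Alg l} :
    u ∈ rootSpace l α ↔ ∀ H : Cartan l, ⁅cartanIncl l H, u⁆ = α H • u := by
  simp [rootSpace, Submodule.mem_iInf]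

theorem cen_der_eq_zero_of_mem_rootSpace {α : Weight l} (hα : α ≠ 0) {u : Alg l}
    (hu : u ∈ rootSpace l α) : u.cen = 0 ∧ u.der = 0 := by
  obtain ⟨H, hH⟩ : ∃ H, α H ≠ 0 := by
    by_contra! h
    exact hα (LinearMap.ext h)
  rw [mem_rootSpace_iff] at hu
  -- The cocycle carries the factor `m`, which is `0` for the `t⁰` component of the Cartan element.
  have hcoc : ∀ f, Loop.cocycle (traceForm l) (Finsupp.single 0 (diag l H.1)) f = 0 := by
    intro f
    induction f using Finsupp.induction_linear with
    | zero => simp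
    | add f g hf hg => rw [map_add, hf, hg, add_zero]
    | single m x => simp
  have h₁ := congrArg Affinization.cen (hu H)
  have h₂ := congrArg Affinization.der (hu H)
  rw [Affinization.lie_cen, Affinization.smul_cen] at h₁
  rw [Affinization.lie_der, Affinization.smul_der] at h₂
  exact ⟨(mul_eq_zero.mp (h₁.symm.trans (hcoc _))).resolve_left hH,
    (mul_eq_zero.mp h₂.symm).resolve_left hH⟩

/-- The coordinate of an element of the affine Lie algebra at the node `pr ⊗ tⁿ`. -/
def coord (v : Node l) : Alg l →ₗ[ℂ] ℂ where
  toFun u := (u.loop v.power).1 v.col v.row.swap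
  map_add' u w := by simp
  map_smul' a u := by simp

theorem coord_apply (v : Node l) (u : Alg l) :
    coord v u = (u.loop v.power).1 v.col v.row.swap := rfl

theorem Letter.wt_swap (p : Letter l) : Letter.wt p.swap = -p.wt := by
  rcases p with i | i <;> simp [Letter.wt]

theorem coord_lie (H : Cartan l) (v : Node l) (u : Alg l) :
    coord v ⁅cartanIncl l H, u⁆ = v.wt H * coord v u := by
  rw [coord_apply, lie_cartanIncl_entry, coord_apply, Letter.wt_swap]
  simp [Node.wt, delta]

/-- By the symmetry in `mem_sp_iff`, entries outside the triangle agree up to sign with entries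
inside it. -/
theorem eq_zero_of_coord_eq_zero {u : Alg l} (hc : u.cen = 0) (hd : u.der = 0)
    (h : ∀ v, coord v u = 0) : u = 0 := by
  ext1
  · ext n p q : 4
    have hX := (mem_sp_iff (u.loop n).1).1 (u.loop n).2 p q.swap
    have hq : q.swap.swap = q := Sum.swap_swap q
    rw [hq] at hX
    change (u.loop n).1 p q = 0
    rcases le_total (Letter.pos q.swap) (Letter.pos p) with hle | hle
    · have := h ⟨p, q.swap, n, hle⟩
      rwa [coord_apply, hq] at this
    · have := h ⟨q.swap, p, n, hle⟩
      rw [coord_apply] at this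
      rw [hX]
      simp only at this
      rw [this, mul_zero]
  · exact hc
  · exact hd

/-- The matrix of `sp(2l, ℂ)` attached to a pair of letters. -/
def pairMatrix (p r : Letter l) : LieAlgebra.Symplectic.sp (Fin l) ℂ :=
  ⟨Matrix.of fun a b => if a = p ∧ b.swap = r then 1
    -- For `p = r` the first branch takes precedence, so the entry is `1` and the root vectors are
    -- exactly dual to `coord`.
    else if a = r ∧ b.swap = p then p.sign * r.sign else 0, by
    rw [mem_sp_iff]
    intro a b
    simp only [Matrix.of_apply, Sum.swap_swap]
    have hp := p.sign_mul_self
    have hr := r.sign_mul_self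
    split_ifs <;> grind⟩

/-- The root vector attached to a node. -/
def rootVector (v : Node l) : Alg l :=
  ⟨Finsupp.single v.power (pairMatrix v.col v.row), 0, 0⟩

theorem coord_rootVector (w v : Node l) : coord w (rootVector v) = if w = v then 1 else 0 := by
  obtain ⟨p, r, n, h⟩ := v
  obtain ⟨p', r', n', h'⟩ := w
  rw [coord_apply]
  simp only [rootVector, Finsupp.single_apply, Node.mk.injEq]
  by_cases hn : n = n'
  · subst hn
    simp only [if_true, pairMatrix, Matrix.of_apply, Sum.swap_swap, and_true]
    split_ifs with h₁ h₂
    · rfl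
    -- The transposed pair lies in the triangle only if the two letters coincide, and then the first
    -- branch applied already.
    · obtain ⟨rfl, rfl⟩ := h₂
      exact absurd ⟨Letter.pos_injective (le_antisymm h h'),
        Letter.pos_injective (le_antisymm h' h)⟩ h₁
    · rfl
  · rw [if_neg hn, if_neg (fun e => hn e.2.2.symm)]
    rfl

theorem rootVector_mem_rootSpace (v : Node l) : rootVector v ∈ rootSpace l v.wt := by
  rw [mem_rootSpace_iff]
  intro H
  rw [← sub_eq_zero]
  apply eq_zero_of_coord_eq_zero
  · rw [Affinization.sub_cen, Affinization.lie_cen]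
    simp [cartanIncl, rootVector]
  · rw [Affinization.sub_der, Affinization.lie_der]
    simp [rootVector]
  · intro w
    rw [map_sub, coord_lie, map_smul, coord_rootVector, smul_eq_mul]
    split_ifs with h
    · rw [h, sub_self]
    · simp

theorem rootVector_ne_zero (v : Node l) : rootVector v ≠ 0 := fun h => by
  have := coord_rootVector v v
  simp [h] at this

theorem linearIndependent_rootVector : LinearIndependent ℂ (rootVector (l := l)) := by
  rw [linearIndependent_iff']
  intro s g hg v hv
  have := congrArg (coord v) hg
  simpa [map_sum, coord_rootVector, hv] using this

theorem wt_mem_roots {v : Node l} (hv : v.wt ≠ 0) : v.wt ∈ roots l :=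
  ⟨hv, fun h => rootVector_ne_zero v
    ((Submodule.mem_bot ℂ).1 (h ▸ rootVector_mem_rootSpace v))⟩

/-- Taking the coordinate at `v` of the eigenvalue equation shows that an element of weight `α` has
nonzero coordinates only at nodes of weight `α`; finiteness lets it be written as the sum of its
coordinates times root vectors. -/
theorem gradedPiece_eq_span (s : Fin (l + 1) → ℕ) (j : ℤ)
    (hfin : {v : Node l | v.wt ∈ rootsOfDegree l s j}.Finite) :
    gradedPiece l s j = Submodule.span ℂ (rootVector '' {v | v.wt ∈ rootsOfDegree l s j}) := by
  apply le_antisymm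
  · refine iSup₂_le fun α hα u hu => ?_
    obtain ⟨hc, hd⟩ := cen_der_eq_zero_of_mem_rootSpace hα.1.1 hu
    have hzero : ∀ v ∉ hfin.toFinset, coord v u = 0 := by
      intro v hv
      by_contra hne
      apply hv
      have : v.wt = α := by
        refine LinearMap.ext fun H => ?_
        have h := congrArg (coord v) (mem_rootSpace_iff.1 hu H)
        rw [coord_lie, map_smul, smul_eq_mul] at h
        exact mul_right_cancel₀ hne h
      simpa [this] using hα
    have hsum : u = ∑ v ∈ hfin.toFinset, coord v u • rootVector v := by
      rw [← sub_eq_zero]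
      have hcen : ∀ (t : Finset (Node l)) (f : Node l → ℂ),
          (∑ v ∈ t, f v • rootVector v).cen = 0 ∧ (∑ v ∈ t, f v • rootVector v).der = 0 := by
        intro t f
        induction t using Finset.cons_induction with
        | empty => simp
        | cons a t ha ih =>
          rw [Finset.sum_cons, Affinization.add_cen, Affinization.add_der, ih.1, ih.2]
          simp only [Affinization.smul_cen, Affinization.smul_der, rootVector]
          simp
      apply eq_zero_of_coord_eq_zero
      · rw [Affinization.sub_cen, hc, (hcen _ _).1, sub_zero]
      · rw [Affinization.sub_der, hd, (hcen _ _).2, sub_zero]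
      · intro w
        simp only [map_sub, map_smul, map_sum, coord_rootVector, smul_eq_mul, mul_ite, mul_one,
          mul_zero, Finset.sum_ite_eq]
        split_ifs with hw
        · ring
        · rw [hzero w hw]; ring
    rw [hsum]
    refine Submodule.sum_mem _ fun v hv => Submodule.smul_mem _ _ (Submodule.subset_span ?_)
    exact ⟨v, by simpa using hv, rfl⟩
  · rw [Submodule.span_le]
    rintro _ ⟨v, hv, rfl⟩
    exact Submodule.mem_iSup_of_mem v.wt
      (Submodule.mem_iSup_of_mem hv (rootVector_mem_rootSpace v))

theorem finiteDimensional_gradedPiece (s : Fin (l + 1) → ℕ) (j : ℤ)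
    (hfin : {v : Node l | v.wt ∈ rootsOfDegree l s j}.Finite) :
    FiniteDimensional ℂ (gradedPiece l s j) := by
  rw [gradedPiece_eq_span s j hfin]
  exact FiniteDimensional.span_of_finite ℂ (hfin.image _)

theorem finrank_gradedPiece (s : Fin (l + 1) → ℕ) (j : ℤ)
    (hfin : {v : Node l | v.wt ∈ rootsOfDegree l s j}.Finite) :
    Module.finrank ℂ (gradedPiece l s j) = {v : Node l | v.wt ∈ rootsOfDegree l s j}.ncard := by
  have := hfin.fintype
  rw [gradedPiece_eq_span s j hfin, Set.image_eq_range, ← Nat.card_coe_set_eq,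
    Nat.card_eq_fintype_card]
  exact finrank_span_eq_card (linearIndependent_rootVector.comp _ Subtype.val_injective)

/-! ### Degrees of nodes -/

/-- The sequence `(2, 1, …, 1, N - 2l)`, which is `(2, 1, …, 1, 2)` for `N = 2l + 2` and
`(2, 1, …, 1)` for `N = 2l + 1`. -/
def seqOfPeriod (l N : ℕ) (i : Fin (l + 1)) : ℕ :=
  if i.1 = 0 then 2 else if i.1 = l then N - 2 * l else 1

theorem seq212_eq (l : ℕ) : seq212 l = seqOfPeriod l (2 * l + 2) := by
  funext i
  simp only [seq212, seqOfPeriod]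
  split_ifs <;> omega

theorem seq21_eq (l : ℕ) : seq21 l = seqOfPeriod l (2 * l + 1) := by
  funext i
  simp only [seq21, seqOfPeriod]
  split_ifs <;> omega

/-- The element of the Cartan subalgebra on which the simple roots take the values
`seqOfPeriod l N`, so that `δ` takes the value `N`. -/
def grading (l N : ℕ) : Cartan l := (fun i => (N : ℂ) / 2 - ((i : ℕ) + 1), 0, N)

theorem simpleRoot_grading (hl : 1 ≤ l) {N : ℕ} (hN : 2 * l ≤ N) (i : Fin (l + 1)) :
    simpleRoot l i (grading l N) = seqOfPeriod l N i := by
  have hi := i.2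
  have key : ∀ k : ℕ, 1 ≤ k → k ≤ l → epsN l k (grading l N) = (N : ℂ) / 2 - k := by
    intro k h₁ h₂
    rw [epsN, dif_pos ⟨h₁, h₂⟩]
    simp only [eps, grading, LinearMap.comp_apply, LinearMap.fst_apply, LinearMap.proj_apply]
    rw [Nat.cast_sub h₁]
    push_cast
    ring
  unfold simpleRoot seqOfPeriod
  split_ifs with h₁ h₂
  · rw [LinearMap.sub_apply, LinearMap.smul_apply, key 1 le_rfl hl]
    simp only [delta, grading, LinearMap.comp_apply, LinearMap.snd_apply, nsmul_eq_mul]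
    push_cast
    ring
  -- `2 * l ≤ N` keeps the last entry `N - 2 * l` from being truncated.
  · rw [LinearMap.smul_apply, key l hl le_rfl, Nat.cast_sub hN, nsmul_eq_mul]
    push_cast
    ring
  · rw [LinearMap.sub_apply, key _ (by omega) (by omega), key _ (by omega) (by omega)]
    push_cast
    ring

/-- The residue of a letter: `i` for the letter `i` and `N - i` for `ī`. -/
def Letter.residue (N : ℕ) : Letter l → ℤ
  | .inl i => i.1 + 1
  | .inr i => N - 1 - i.1

/-- For a barred letter, `-(N/2 - i) = N/2 - (N - i)`. The two halves `N/2` of a pair give the `+ 1`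
in `Node.degree`. -/
theorem Letter.wt_grading (N : ℕ) (p : Letter l) :
    p.wt (grading l N) = (N : ℂ) / 2 - p.residue N := by
  rcases p with i | i <;> simp [Letter.wt, Letter.residue, eps, grading]
  ring

/-- The degree of a node with respect to `seqOfPeriod l N`. -/
def Node.degree (N : ℕ) (v : Node l) : ℤ :=
  N * (v.power + 1) - v.col.residue N - v.row.residue N

theorem Node.wt_grading (N : ℕ) (v : Node l) : v.wt (grading l N) = v.degree N := by
  simp only [Node.wt, LinearMap.add_apply, Letter.wt_grading, LinearMap.smul_apply,
    Node.degree]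
  simp [delta, grading]
  ring

/-- The sum of the first `a` coordinates of minus the weight of a letter. -/
def Letter.partialSum (a : ℕ) : Letter l → ℤ
  | .inl i => if i.1 < a then -1 else 0
  | .inr i => if i.1 < a then 1 else 0

/-- The coefficients of minus the weight of a node with respect to the simple roots. -/
def Node.coeff (v : Node l) (i : Fin (l + 1)) : ℤ :=
  (-2 * v.power + v.col.partialSum i + v.row.partialSum i) /
    (if i.1 = 0 ∨ i.1 = l then 2 else 1)

/-- The division by 2 is exact: both partial sums vanish at `0`, and both are `±1` at `l`. -/
theorem Node.coeff_mul (v : Node l) (i : Fin (l + 1)) :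
    v.coeff i * (if i.1 = 0 ∨ i.1 = l then 2 else 1) =
      -2 * v.power + v.col.partialSum i + v.row.partialSum i := by
  apply Int.ediv_mul_cancel
  split_ifs with h
  · rcases h with h | h
    · rw [h]
      rcases v.col with i | i <;> rcases v.row with j | j <;>
        simp [Letter.partialSum]
    · rw [h]
      rcases v.col with i | i <;> rcases v.row with j | j <;>
        simp only [Letter.partialSum, i.2, j.2, if_true] <;> omega
  · exact one_dvd _

theorem Node.wt_eq (v : Node l) : v.wt = -∑ i, v.coeff i • simpleRoot l i := by
  have hsum : ∀ H, (-∑ i, v.coeff i • simpleRoot l i) H =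
      -∑ i, (v.coeff i : ℂ) * simpleRoot l i H := by
    intro H
    simp [LinearMap.sum_apply]
  have hcoeff : ∀ i, (v.coeff i : ℂ) * (if i.1 = 0 ∨ i.1 = l then 2 else 1) =
      -2 * v.power + v.col.partialSum i + v.row.partialSum i := by
    intro i
    exact_mod_cast v.coeff_mul i
  have hlet : ∀ (p : Letter l) (j : Fin l), p.wt (Pi.single j 1, 0, 0) =
      (p.partialSum j.1 : ℂ) - p.partialSum (j.1 + 1) := by
    intro p j
    rcases p with i | i <;>
      simp only [Letter.wt, eps, Letter.partialSum, LinearMap.neg_apply, LinearMap.comp_apply,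
        LinearMap.fst_apply, LinearMap.proj_apply, Pi.single_apply, Fin.ext_iff] <;>
      split_ifs <;> first | omega | simp
  have h₁ : ∀ j : Fin l, v.wt (Pi.single j 1, 0, 0) =
      (-∑ i, v.coeff i • simpleRoot l i) (Pi.single j 1, 0, 0) := by
    intro j
    have hj := j.2
    rw [hsum]
    -- Only two simple roots see this coordinate. Their values `±2` at the ends of the diagram
    -- cancel the halving in `coeff`, leaving a difference of consecutive partial sums.
    have : ∀ i, (v.coeff i : ℂ) * simpleRoot l i (Pi.single j 1, 0, 0) =
        (if i = j.succ then
          (v.coeff i : ℂ) * (if i.1 = 0 ∨ i.1 = l then 2 else 1) else 0) -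
        (if i = j.castSucc then
          (v.coeff i : ℂ) * (if i.1 = 0 ∨ i.1 = l then 2 else 1) else 0) := by
      intro i
      rw [simpleRoot_apply_single]
      simp only [Fin.ext_iff, Fin.val_succ, Fin.val_castSucc]
      split_ifs <;> first | omega | simp
    simp only [this, Finset.sum_sub_distrib, Finset.sum_ite_eq', Finset.mem_univ, if_true, hcoeff]
    simp only [Node.wt, LinearMap.add_apply, LinearMap.smul_apply, hlet, Fin.val_succ,
      Fin.val_castSucc]
    simp [delta]
    ring
  have h₂ : v.wt (0, 0, 1) = (-∑ i, v.coeff i • simpleRoot l i) (0, 0, 1) := by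
    rw [hsum]
    simp only [simpleRoot_apply_der, mul_ite, mul_one, mul_zero]
    have hz : ∀ i : Fin (l + 1), i.1 = 0 ↔ i = 0 := fun i => Fin.val_eq_zero_iff
    simp only [hz, Finset.sum_ite_eq', Finset.mem_univ, if_true]
    have h0 := hcoeff 0
    have hps : ∀ p : Letter l, p.partialSum 0 = 0 := by
      intro p
      rcases p with i | i <;> simp [Letter.partialSum]
    have hwt : ∀ p : Letter l, p.wt (0, 0, 1) = 0 := by
      intro p
      rcases p with i | i <;> simp [Letter.wt, eps]
    simp only [Fin.val_zero, hps, true_or, if_true] at h0 ⊢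
    simp only [Node.wt, LinearMap.add_apply, hwt, LinearMap.smul_apply]
    simp [delta]
    push_cast at h0
    linear_combination h0 / 2
  have h₃ : v.wt (0, 1, 0) = (-∑ i, v.coeff i • simpleRoot l i) (0, 1, 0) := by
    have hε : ∀ i, eps l i (0, 1, 0) = 0 := by simp [eps]
    have hε' : ∀ k, epsN l k (0, 1, 0) = 0 := by
      intro k
      unfold epsN
      split_ifs <;> simp [hε]
    have hδ : delta l (0, 1, 0) = 0 := by simp [delta]
    have hwt : ∀ p : Letter l, p.wt (0, 1, 0) = 0 := by
      intro p
      rcases p with i | i <;> simp [Letter.wt, hε]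
    have hs : ∀ i, simpleRoot l i (0, 1, 0) = 0 := by
      intro i
      unfold simpleRoot
      split_ifs <;> simp [hε', hδ]
    rw [hsum]
    simp [hs, Node.wt, hwt, hδ]
  ext x
  · exact h₁ x
  · simpa using h₃
  · simpa using h₂

/-- Negative degree forces `power ≤ 0`. If `power < 0`, the term `-2 * power ≥ 2` absorbs two
partial sums `≥ -1`. If `power = 0`, the residues sum to more than `N > 2l`, so the letters are not
both unbarred, and in a mixed pair the barred index is the smaller one. -/
theorem Node.coeff_nonneg {N : ℕ} (hN : 2 * l + 1 ≤ N) {v : Node l} (hv : v.degree N < 0)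
    (i : Fin (l + 1)) : 0 ≤ v.coeff i := by
  have hres : ∀ p : Letter l, p.residue N ≤ N - 1 := by
    intro p
    rcases p with i | i <;> simp only [Letter.residue] <;> omega
  have hps : ∀ p : Letter l, -1 ≤ p.partialSum i := by
    intro p
    rcases p with i | i <;> simp only [Letter.partialSum] <;> split_ifs <;> omega
  have hp : v.power ≤ 0 := by
    by_contra! h
    have h₁ := hres v.col
    have h₂ := hres v.row
    unfold Node.degree at hv
    nlinarith
  apply Int.ediv_nonneg
  · rcases hp.lt_or_eq with h | h
    · have h₁ := hps v.col
      have h₂ := hps v.row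
      omega
    · unfold Node.degree at hv
      rw [h] at hv ⊢
      revert hv
      rcases v.col with a | a <;> rcases v.row with b | b <;>
        simp only [Letter.residue, Letter.partialSum] <;> split_ifs <;> omega
  · split_ifs <;> norm_num

/-- Evaluation at the grading element computes the degree from any expansion in simple roots, and
`Node.wt_eq` supplies an integral one. A nonzero degree rules out weight `0`. -/
theorem Node.wt_mem_rootsOfDegree_iff (hl : 1 ≤ l) {N : ℕ} (hN : 2 * l + 1 ≤ N) {j : ℤ}
    (hj : j ≠ 0) (v : Node l) :
    v.wt ∈ rootsOfDegree l (seqOfPeriod l N) j ↔ v.degree N = j := by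
  have hdeg : ∀ k : Fin (l + 1) → ℤ, v.wt = ∑ i, k i • simpleRoot l i →
      v.degree N = ∑ i, k i * (seqOfPeriod l N i : ℤ) := by
    intro k hk
    have := v.wt_grading N
    rw [hk] at this
    simp only [LinearMap.sum_apply, LinearMap.smul_apply,
      simpleRoot_grading hl (by omega : 2 * l ≤ N), zsmul_eq_mul] at this
    exact_mod_cast this.symm
  constructor
  · rintro ⟨-, k, hk, hkj⟩
    rw [hdeg k hk, hkj]
  · intro h
    have hk : v.wt = ∑ i, (-v.coeff i) • simpleRoot l i := by
      simpa [neg_smul] using v.wt_eq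
    refine ⟨wt_mem_roots fun h0 => hj ?_, _, hk, by rw [← hdeg _ hk, h]⟩
    have := v.wt_grading N
    rw [h0, h, LinearMap.zero_apply] at this
    exact_mod_cast this.symm

theorem multiplicity_zero {N : ℕ} (hN : 2 * l + 1 ≤ N) :
    multiplicity l (seqOfPeriod l N) 0 = 0 := by
  rw [multiplicity, Set.encard_eq_zero, Set.eq_empty_iff_forall_notMem]
  intro v hv
  apply v.2.choose_spec.1
  funext i
  have h := (Finset.sum_eq_zero_iff.1 hv) i (Finset.mem_univ i)
  refine (Nat.mul_eq_zero.1 h).resolve_right ?_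
  simp only [seqOfPeriod]
  split_ifs <;> first | omega | norm_num

/-- The label is minus the degree, and by `Node.coeff_nonneg` every node of negative degree is
already in the negative array. -/
theorem multiplicity_eq (hl : 1 ≤ l) {N : ℕ} (hN : 2 * l + 1 ≤ N) {m : ℕ} (hm : m ≠ 0) :
    multiplicity l (seqOfPeriod l N) m = {v : Node l | v.degree N = -m}.encard := by
  have hlabel : ∀ v : NegNode l, (specializedArray l (seqOfPeriod l N) v : ℤ) = -v.1.degree N := by
    intro v
    have h₁ := v.1.wt_grading N
    rw [v.2.choose_spec.2] at h₁
    simp only [LinearMap.neg_apply, LinearMap.sum_apply, LinearMap.smul_apply,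
      simpleRoot_grading hl (by omega : 2 * l ≤ N), nsmul_eq_mul] at h₁
    rw [eq_neg_iff_add_eq_zero, specializedArray]
    have h₂ : ((∑ i, v.2.choose i * seqOfPeriod l N i : ℕ) : ℂ) + (v.1.degree N : ℂ) = 0 := by
      rw [← h₁]
      push_cast
      ring
    exact_mod_cast h₂
  have hinj : Function.Injective (fun v : NegNode l => v.1) := Subtype.val_injective
  rw [multiplicity, ← hinj.encard_image]
  congr 1
  ext v
  constructor
  · rintro ⟨w, hw, rfl⟩
    have := hlabel w
    rw [Set.mem_ofPred_eq] at hw ⊢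
    rw [hw] at this
    linarith
  · intro hv
    rw [Set.mem_ofPred_eq] at hv
    have hnn := Node.coeff_nonneg hN (v := v) (by omega)
    have hwt : v.wt = -∑ i, (v.coeff i).toNat • simpleRoot l i := by
      rw [v.wt_eq]
      congr 1
      refine Finset.sum_congr rfl fun i _ => ?_
      rw [← natCast_zsmul, Int.toNat_of_nonneg (hnn i)]
    have hne : (fun i => (v.coeff i).toNat) ≠ 0 := fun h0 => by
      have h₁ := v.wt_grading N
      have h₂ : ∑ i, (v.coeff i).toNat • simpleRoot l i = 0 :=
        Finset.sum_eq_zero fun i _ => by rw [congrFun h0 i, Pi.zero_apply, zero_smul]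
      rw [hwt, h₂, neg_zero, LinearMap.zero_apply, hv] at h₁
      have : (-m : ℤ) = 0 := by exact_mod_cast h₁.symm
      omega
    obtain ⟨w, hw⟩ : ∃ w : NegNode l, w.1 = v := ⟨⟨v, _, hne, hwt⟩, rfl⟩
    refine ⟨w, ?_, hw⟩
    have := hlabel w
    rw [hw, hv] at this
    rw [Set.mem_ofPred_eq]
    omega

/-! ### Counting nodes of a given degree -/

theorem Letter.residue_le_iff {N : ℕ} (hN : 2 * l + 1 ≤ N) (p q : Letter l) :
    p.residue N ≤ q.residue N ↔ p.pos ≤ q.pos := by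
  rcases p with i | i <;> rcases q with j | j <;> simp only [Letter.residue, Letter.pos] <;> omega

theorem Letter.residue_injective {N : ℕ} (hN : 2 * l + 1 ≤ N) :
    Function.Injective (Letter.residue (l := l) N) := fun p q h =>
  Letter.pos_injective (le_antisymm ((residue_le_iff hN p q).1 h.le)
    ((residue_le_iff hN q p).1 h.ge))

theorem Letter.exists_residue_eq_iff {N : ℕ} (x : ℤ) :
    (∃ p : Letter l, p.residue N = x) ↔ 1 ≤ x ∧ x ≤ l ∨ N - l ≤ x ∧ x < N := by
  constructor
  · rintro ⟨i | i, rfl⟩ <;> simp only [Letter.residue] <;> omega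
  · rintro (h | h)
    · exact ⟨.inl ⟨(x - 1).toNat, by omega⟩, by simp only [Letter.residue]; omega⟩
    · exact ⟨.inr ⟨(N - 1 - x).toNat, by omega⟩, by simp only [Letter.residue]; omega⟩

/-- Two residues in `[1, N - 1]` sum to a number in `[2, 2N - 2]`; being congruent to `M` modulo
`N`, it is `M` or `M + N`. -/
theorem Node.degree_eq_iff {N : ℕ} (hN : 2 * l + 1 ≤ N) {M t : ℤ} (hM : 0 ≤ M) (hMN : M < N)
    (v : Node l) : v.degree N = N * t - M ↔
      v.row.residue N + v.col.residue N = M ∧ v.power = t - 1 ∨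
      v.row.residue N + v.col.residue N = M + N ∧ v.power = t := by
  have h₁ := (Letter.exists_residue_eq_iff (N := N) _).1 ⟨v.row, rfl⟩
  have h₂ := (Letter.exists_residue_eq_iff (N := N) _).1 ⟨v.col, rfl⟩
  replace h₁ : 1 ≤ v.row.residue N ∧ v.row.residue N < N := by omega
  replace h₂ : 1 ≤ v.col.residue N ∧ v.col.residue N < N := by omega
  unfold Node.degree
  constructor
  · intro h
    have hz : (N : ℤ) * (v.power + 1 - t) = v.row.residue N + v.col.residue N - M := by
      linear_combination h
    have hlow : -1 < v.power + 1 - t := by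
      by_contra! hc
      nlinarith
    have hupp : v.power + 1 - t < 2 := by
      by_contra! hc
      nlinarith
    obtain hc | hc : v.power + 1 - t = 0 ∨ v.power + 1 - t = 1 := by omega
    · rw [hc] at hz
      left
      constructor <;> linarith
    · rw [hc] at hz
      right
      constructor <;> linarith
  · rintro (⟨h, hp⟩ | ⟨h, hp⟩) <;> rw [hp] <;> linear_combination -h

/-- A node of given degree is determined by the smaller residue `x`, that of its row. -/
theorem encard_degree_eq_residues {N : ℕ} (hN : 2 * l + 1 ≤ N) {M t : ℤ} (hM : 0 ≤ M)
    (hMN : M < N) : {v : Node l | v.degree N = N * t - M}.encard =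
      {x : ℤ | (1 ≤ x ∧ x ≤ l ∨ N - l ≤ x ∧ x < N) ∧ ∃ y, x ≤ y ∧
        (1 ≤ y ∧ y ≤ l ∨ N - l ≤ y ∧ y < N) ∧ (x + y = M ∨ x + y = M + N)}.encard := by
  have hinj : Set.InjOn (fun v : Node l => v.row.residue N) {v | v.degree N = N * t - M} := by
    rintro v hv w hw h
    rw [Set.mem_ofPred_eq, Node.degree_eq_iff hN hM hMN] at hv hw
    have h₁ := (Letter.exists_residue_eq_iff (N := N) _).1 ⟨v.col, rfl⟩
    have h₂ := (Letter.exists_residue_eq_iff (N := N) _).1 ⟨w.col, rfl⟩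
    simp only at h
    have hrow : v.row = w.row := Letter.residue_injective hN h
    -- With equal rows, the sums `M` and `M + N` would need column residues differing by `N`, which
    -- is impossible in `[1, N - 1]`.
    have hcol : v.col = w.col := Letter.residue_injective hN (by omega)
    have hpow : v.power = w.power := by omega
    cases v
    cases w
    simp_all
  rw [← hinj.encard_image]
  congr 1
  ext x
  constructor
  · rintro ⟨v, hv, rfl⟩
    rw [Set.mem_ofPred_eq, Node.degree_eq_iff hN hM hMN] at hv
    refine ⟨(Letter.exists_residue_eq_iff _).1 ⟨v.row, rfl⟩, v.col.residue N,
      (Letter.residue_le_iff hN _ _).2 v.row_le_col,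
      (Letter.exists_residue_eq_iff _).1 ⟨v.col, rfl⟩, hv.imp And.left And.left⟩
  · rintro ⟨hx, y, hxy, hy, hsum⟩
    obtain ⟨r, rfl⟩ := (Letter.exists_residue_eq_iff _).2 hx
    obtain ⟨p, rfl⟩ := (Letter.exists_residue_eq_iff _).2 hy
    have hle := (Letter.residue_le_iff hN _ _).1 hxy
    rcases hsum with h | h
    · exact ⟨⟨p, r, t - 1, hle⟩, (Node.degree_eq_iff hN hM hMN _).2 (.inl ⟨h, rfl⟩), rfl⟩
    · exact ⟨⟨p, r, t, hle⟩, (Node.degree_eq_iff hN hM hMN _).2 (.inr ⟨h, rfl⟩), rfl⟩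

theorem card_Icc_union_Icc {N : ℕ} {M : ℤ} (hM : 0 ≤ M) (hMN : M < N) :
    (Finset.Icc 1 (M / 2) ∪ Finset.Icc (M + 1) ((M + N) / 2)).card =
      (M / 2 + ((M + N) / 2 - M)).toNat := by
  rw [Finset.card_union_of_disjoint, Int.card_Icc, Int.card_Icc]
  · omega
  · rw [Finset.disjoint_left]
    intro x
    simp only [Finset.mem_Icc]
    omega

/-- Sum `M` allows `1 ≤ x ≤ M/2`; sum `M + N` allows `M < x ≤ (M + N)/2`, because `y < N`. As `M`
and `M + N` have opposite parity, the floors add up to `M + l`. -/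
theorem encard_degree_odd_period {M t : ℤ} (hM : 0 ≤ M) (hMN : M < (2 * l + 1 : ℕ)) :
    {v : Node l | v.degree (2 * l + 1) = (2 * l + 1 : ℕ) * t - M}.encard = l := by
  rw [encard_degree_eq_residues le_rfl hM hMN]
  have : {x : ℤ | (1 ≤ x ∧ x ≤ l ∨ (2 * l + 1 : ℕ) - l ≤ x ∧ x < (2 * l + 1 : ℕ)) ∧ ∃ y, x ≤ y ∧
        (1 ≤ y ∧ y ≤ l ∨ (2 * l + 1 : ℕ) - l ≤ y ∧ y < (2 * l + 1 : ℕ)) ∧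
        (x + y = M ∨ x + y = M + (2 * l + 1 : ℕ))} =
      (Finset.Icc 1 (M / 2) ∪ Finset.Icc (M + 1) ((M + (2 * l + 1 : ℕ)) / 2) : Finset ℤ) := by
    ext x
    simp only [Set.mem_ofPred_eq, Finset.coe_union, Set.mem_union, Finset.coe_Icc, Set.mem_Icc]
    constructor
    · rintro ⟨hx, y, hxy, hy, h⟩
      omega
    · rintro (h | h)
      · exact ⟨by omega, M - x, by omega, by omega, by omega⟩
      · exact ⟨by omega, M + (2 * l + 1 : ℕ) - x, by omega, by omega, by omega⟩
  rw [this, Set.encard_coe_eq_coe_finsetCard, card_Icc_union_Icc hM hMN]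
  congr 1
  omega

theorem encard_degree_even_period (hl : 1 ≤ l) {M t : ℤ} (hM : 0 ≤ M)
    (hMN : M < (2 * l + 2 : ℕ)) :
    {v : Node l | v.degree (2 * l + 2) = (2 * l + 2 : ℕ) * t - M}.encard =
      ((l - 1 + (if Even M then 1 else 0) + (if M = l + 1 then 1 else 0) : ℕ) : ℕ∞) := by
  rw [encard_degree_eq_residues (by omega) hM hMN]
  -- The erased `x` is the smaller member of the pair containing the missing residue `l + 1`. For `M
  -- = l + 1` it would be `0`, which is absent anyway, so nothing is lost.
  have : {x : ℤ | (1 ≤ x ∧ x ≤ l ∨ (2 * l + 2 : ℕ) - l ≤ x ∧ x < (2 * l + 2 : ℕ)) ∧ ∃ y, x ≤ y ∧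
        (1 ≤ y ∧ y ≤ l ∨ (2 * l + 2 : ℕ) - l ≤ y ∧ y < (2 * l + 2 : ℕ)) ∧
        (x + y = M ∨ x + y = M + (2 * l + 2 : ℕ))} =
      ((Finset.Icc 1 (M / 2) ∪ Finset.Icc (M + 1) ((M + (2 * l + 2 : ℕ)) / 2)).erase
        (if M < l + 1 then l + 1 else M - (l + 1)) : Finset ℤ) := by
    ext x
    simp only [Set.mem_ofPred_eq, Finset.mem_coe, Finset.mem_erase, Finset.mem_union,
      Finset.mem_Icc]
    constructor
    · rintro ⟨hx, y, hxy, hy, h⟩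
      split_ifs <;> omega
    · rintro ⟨hne, h | h⟩
      · exact ⟨by split_ifs at hne <;> omega, M - x, by omega,
          by split_ifs at hne <;> omega, by omega⟩
      · exact ⟨by split_ifs at hne <;> omega, M + (2 * l + 2 : ℕ) - x, by omega,
          by split_ifs at hne <;> omega, by omega⟩
  rw [this, Set.encard_coe_eq_coe_finsetCard]
  congr 1
  by_cases hM' : M = l + 1
  · rw [Finset.erase_eq_of_notMem, card_Icc_union_Icc hM hMN, if_pos hM']
    · simp only [Int.even_iff]
      split_ifs <;> omega
    · simp only [Finset.mem_union, Finset.mem_Icc]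
      split_ifs <;> omega
  · rw [Finset.card_erase_of_mem, card_Icc_union_Icc hM hMN, if_neg hM']
    · simp only [Int.even_iff]
      split_ifs <;> omega
    · simp only [Finset.mem_union, Finset.mem_Icc]
      split_ifs <;> omega

end AffineC

/-! ### Infinite products of power series -/

/-- The `j`-th factor differs from `1` by a series of order at least `j`, and these orders tend to
infinity. -/
theorem PowerSeries.multipliable_of_X_pow_dvd_sub_one {g : ℕ+ → ℂ⟦X⟧}
    (h : ∀ j : ℕ+, (X : ℂ⟦X⟧) ^ (j : ℕ) ∣ g j - 1) : Multipliable g := by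
  have hg : g = fun j => 1 + (g j - 1) := by
    funext j
    ring
  rw [hg]
  apply WithPiTopology.multipliable_one_add_of_tendsto_order_atTop_nhds_top
  refine ENat.tendsto_nhds_top_iff_natCast_lt.mpr fun n =>
    Filter.eventually_atTop.mpr ⟨n.succPNat, fun m hm => ?_⟩
  have hm' : n + 1 ≤ (m : ℕ) := hm
  calc (n : ℕ∞) < (m : ℕ) := by exact_mod_cast hm'
    _ ≤ (g m - 1).order := PowerSeries.nat_le_order _ _ (X_pow_dvd_iff.1 (h m))

theorem PowerSeries.X_pow_dvd_one_sub_X_pow_pow_sub_one {m n : ℕ} (hmn : m ≤ n) (e : ℕ) :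
    (X : ℂ⟦X⟧) ^ m ∣ (1 - X ^ n) ^ e - 1 := by
  refine dvd_trans ?_ (sub_one_dvd_pow_sub_one _ e)
  rw [sub_sub_cancel_left, dvd_neg]
  exact pow_dvd_pow _ hmn

theorem PowerSeries.multipliable_one_sub_X_pow_pow (e : ℕ+ → ℕ) :
    Multipliable fun j : ℕ+ => (1 - X ^ (j : ℕ) : ℂ⟦X⟧) ^ e j :=
  multipliable_of_X_pow_dvd_sub_one fun _ => X_pow_dvd_one_sub_X_pow_pow_sub_one le_rfl _

theorem PowerSeries.multipliable_one_sub_X_pow_two_mul :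
    Multipliable fun j : ℕ+ => (1 - X ^ (2 * (j : ℕ)) : ℂ⟦X⟧) :=
  multipliable_of_X_pow_dvd_sub_one fun j => by
    simpa using X_pow_dvd_one_sub_X_pow_pow_sub_one (by omega : (j : ℕ) ≤ 2 * j) 1

theorem PowerSeries.mulIndicator_one_sub_X_pow (p : ℕ+ → Prop) [DecidablePred p] :
    Set.mulIndicator {j | p j} (fun j : ℕ+ => (1 - X ^ (j : ℕ) : ℂ⟦X⟧)) =
      fun j : ℕ+ => (1 - X ^ (j : ℕ) : ℂ⟦X⟧) ^ (if p j then 1 else 0) := by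
  funext j
  by_cases h : p j <;> simp [Set.mulIndicator, h]

theorem PowerSeries.multipliable_one_sub_X_pow_subtype (p : ℕ+ → Prop) :
    Multipliable fun j : {j : ℕ+ // p j} => (1 - X ^ (j.1 : ℕ) : ℂ⟦X⟧) := by
  classical
  refine (multipliable_subtype_iff_mulIndicator (s := {j | p j})
    (f := fun j : ℕ+ => (1 - X ^ (j : ℕ) : ℂ⟦X⟧))).2 ?_
  rw [mulIndicator_one_sub_X_pow]
  exact multipliable_one_sub_X_pow_pow _

/-- A restricted product becomes a full one with exponents `0` and `1`, so that it can be multiplied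
factor by factor with the others. -/
theorem PowerSeries.tprod_one_sub_X_pow_subtype (p : ℕ+ → Prop) [DecidablePred p] :
    ∏' j : {j : ℕ+ // p j}, (1 - X ^ (j.1 : ℕ) : ℂ⟦X⟧) =
      ∏' j : ℕ+, (1 - X ^ (j : ℕ) : ℂ⟦X⟧) ^ (if p j then 1 else 0) := by
  rw [← mulIndicator_one_sub_X_pow]
  exact tprod_subtype {j | p j} (fun j : ℕ+ => (1 - X ^ (j : ℕ) : ℂ⟦X⟧))

theorem PowerSeries.tprod_one_sub_X_pow_two_mul :
    ∏' j : ℕ+, (1 - X ^ (2 * (j : ℕ)) : ℂ⟦X⟧) =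
      ∏' j : ℕ+, (1 - X ^ (j : ℕ) : ℂ⟦X⟧) ^ (if Even (j : ℕ) then 1 else 0) := by
  have hinj : Function.Injective fun j : ℕ+ => 2 * j := fun a b h => by
    simpa using h
  rw [← hinj.tprod_eq
    (f := fun j : ℕ+ => (1 - X ^ (j : ℕ) : ℂ⟦X⟧) ^ (if Even (j : ℕ) then 1 else 0))]
  · refine tprod_congr fun j => ?_
    simp
  · intro j hj
    rw [Function.mem_mulSupport] at hj
    have hev : Even (j : ℕ) := by
      by_contra hodd
      simp [hodd] at hj
    obtain ⟨k, hk⟩ := hev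
    have := j.pos
    exact ⟨⟨k, by omega⟩, PNat.eq (by change 2 * k = (j : ℕ); omega)⟩

/-! ### Dimensions and multiplicities for the two sequences -/

namespace AffineC

variable {l : ℕ}

/-- Graded pieces need degree `m`, labels need degree `-m`. The counts agree because parity is
unchanged by negation and `-(l + 1) ≡ l + 1` modulo `2(l + 1)`. -/
theorem encard_degree_seq212 (hl : 1 ≤ l) {m : ℕ} {e : ℤ} (he : e = m ∨ e = -m) :
    {v : Node l | v.degree (2 * l + 2) = e}.encard =
      ((l - 1 + (if Even m then 1 else 0) +
        (if m ≡ l + 1 [MOD 2 * (l + 1)] then 1 else 0) : ℕ) : ℕ∞) := by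
  have hN : (0 : ℤ) < (2 * l + 2 : ℕ) := by omega
  have h0 := Int.emod_nonneg (-e) hN.ne'
  have hlt := Int.emod_lt_of_pos (-e) hN
  have hdiv := Int.emod_add_mul_ediv (-e) (2 * l + 2 : ℕ)
  -- Division of `-e` by `N` with remainder `M` puts `e` in the form `N * t - M`.
  have key := encard_degree_even_period hl h0 hlt (t := -(-e / (2 * l + 2 : ℕ)))
  rw [show ((2 * l + 2 : ℕ) : ℤ) * -(-e / (2 * l + 2 : ℕ)) - -e % (2 * l + 2 : ℕ) = e by
    linear_combination -hdiv] at key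
  rw [key]
  have heven : Even (-e % (2 * l + 2 : ℕ)) ↔ Even m := by
    have h2 : (2 : ℤ) ∣ (2 * l + 2 : ℕ) := ⟨l + 1, by push_cast; ring⟩
    rw [Int.even_iff, Int.emod_emod_of_dvd _ h2, Nat.even_iff]
    omega
  have hmod : -e % (2 * l + 2 : ℕ) = l + 1 ↔ m ≡ l + 1 [MOD 2 * (l + 1)] := by
    have hl1 : ((l : ℤ) + 1) % (2 * l + 2 : ℕ) = l + 1 := Int.emod_eq_of_lt (by omega) (by omega)
    have hcast : m ≡ l + 1 [MOD 2 * (l + 1)] ↔ ((2 * l + 2 : ℕ) : ℤ) ∣ (l + 1 : ℤ) - m := by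
      rw [Nat.modEq_iff_dvd]
      push_cast
      rw [show (2 * ((l : ℤ) + 1)) = 2 * l + 2 by ring]
    rw [hcast]
    conv_lhs => rw [← hl1]
    rw [Int.emod_eq_emod_iff_emod_sub_eq_zero, ← Int.dvd_iff_emod_eq_zero]
    rcases he with rfl | rfl
    · rw [show -(m : ℤ) - (l + 1) = (l + 1 - m) + ((2 * l + 2 : ℕ) : ℤ) * (-1) by push_cast; ring]
      exact dvd_add_left (Dvd.intro _ rfl)
    · rw [← dvd_neg, neg_neg, neg_sub]
  simp only [heven, hmod]

theorem encard_degree_seq21 (e : ℤ) :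
    {v : Node l | v.degree (2 * l + 1) = e}.encard = l := by
  have hN : (0 : ℤ) < (2 * l + 1 : ℕ) := by omega
  have h0 := Int.emod_nonneg (-e) hN.ne'
  have hlt := Int.emod_lt_of_pos (-e) hN
  have hdiv := Int.emod_add_mul_ediv (-e) (2 * l + 1 : ℕ)
  have key := encard_degree_odd_period h0 hlt (t := -(-e / (2 * l + 1 : ℕ)))
  rwa [show ((2 * l + 1 : ℕ) : ℤ) * -(-e / (2 * l + 1 : ℕ)) - -e % (2 * l + 1 : ℕ) = e by
    linear_combination -hdiv] at key

theorem finrank_gradedPiece_seqOfPeriod (hl : 1 ≤ l) {N : ℕ} (hN : 2 * l + 1 ≤ N) {j : ℤ}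
    (hj : j ≠ 0) {d : ℕ} (hd : {v : Node l | v.degree N = j}.encard = d) :
    FiniteDimensional ℂ (gradedPiece l (seqOfPeriod l N) j) ∧
      Module.finrank ℂ (gradedPiece l (seqOfPeriod l N) j) = d := by
  have hset : {v : Node l | v.wt ∈ rootsOfDegree l (seqOfPeriod l N) j} =
      {v | v.degree N = j} := Set.ext fun v => v.wt_mem_rootsOfDegree_iff hl hN hj
  have hfin : {v : Node l | v.wt ∈ rootsOfDegree l (seqOfPeriod l N) j}.Finite := by
    rw [hset]
    exact Set.finite_of_encard_eq_coe hd
  refine ⟨finiteDimensional_gradedPiece _ _ hfin, ?_⟩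
  rw [finrank_gradedPiece _ _ hfin, hset, Set.ncard, hd, ENat.toNat_natCast]

theorem gradedPiece_seq212 (hl : 1 ≤ l) (j : ℕ+) :
    FiniteDimensional ℂ (gradedPiece l (seq212 l) (j : ℤ)) ∧
      Module.finrank ℂ (gradedPiece l (seq212 l) (j : ℤ)) =
        l - 1 + (if Even (j : ℕ) then 1 else 0) +
          (if (j : ℕ) ≡ l + 1 [MOD 2 * (l + 1)] then 1 else 0) := by
  rw [seq212_eq]
  exact finrank_gradedPiece_seqOfPeriod hl (by omega) (by simp)
    (encard_degree_seq212 hl (.inl rfl))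

theorem gradedPiece_seq21 (hl : 1 ≤ l) (j : ℕ+) :
    FiniteDimensional ℂ (gradedPiece l (seq21 l) (j : ℤ)) ∧
      Module.finrank ℂ (gradedPiece l (seq21 l) (j : ℤ)) = l := by
  rw [seq21_eq]
  exact finrank_gradedPiece_seqOfPeriod hl le_rfl (by simp) (encard_degree_seq21 _)

theorem multiplicity_seq212 (hl : 1 ≤ l) (m : ℕ) : multiplicity l (seq212 l) m =
    if m = 0 then 0
    else ((l - 1 : ℕ) : ℕ∞) + (if Even m then 1 else 0)
      + (if m ≡ l + 1 [MOD 2 * (l + 1)] then 1 else 0) := by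
  rw [seq212_eq]
  by_cases hm : m = 0
  · rw [if_pos hm, hm, multiplicity_zero (by omega)]
  · rw [if_neg hm, multiplicity_eq hl (by omega) hm, encard_degree_seq212 hl (.inr rfl)]
    simp only [Nat.cast_add, Nat.cast_ite, Nat.cast_one, Nat.cast_zero]

theorem multiplicity_seq21 (hl : 1 ≤ l) (m : ℕ) :
    multiplicity l (seq21 l) m = if m = 0 then 0 else (l : ℕ∞) := by
  rw [seq21_eq]
  split_ifs with hm
  · rw [hm, multiplicity_zero le_rfl]
  · rw [multiplicity_eq hl le_rfl hm, encard_degree_seq21]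

end AffineC

end

theorem mainTheorem11 (l : ℕ) (hl : 1 ≤ l) :
    -- the array for `(2, 1, …, 1, 2)`
    (∀ m : ℕ, AffineC.multiplicity l (AffineC.seq212 l) m =
      if m = 0 then 0
      else ((l - 1 : ℕ) : ℕ∞) + (if Even m then 1 else 0)
        + (if m ≡ l + 1 [MOD 2 * (l + 1)] then 1 else 0)) ∧
    -- the denominator for `(2, 1, …, 1, 2)`
    (∀ j : ℕ+, FiniteDimensional ℂ (AffineC.gradedPiece l (AffineC.seq212 l) (j : ℤ))) ∧
    Multipliable (AffineC.denominatorFactor l (AffineC.seq212 l)) ∧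
    Multipliable (fun i : ℕ+ => (1 - PowerSeries.X ^ (i : ℕ) : ℂ⟦X⟧) ^ (l - 1)) ∧
    Multipliable (fun j : ℕ+ => (1 - PowerSeries.X ^ (2 * (j : ℕ)) : ℂ⟦X⟧)) ∧
    Multipliable (fun r : {r : ℕ+ // (r : ℕ) ≡ l + 1 [MOD 2 * (l + 1)]} =>
      (1 - PowerSeries.X ^ (r.1 : ℕ) : ℂ⟦X⟧)) ∧
    AffineC.Q l (AffineC.seq212 l) =
      (∏' i : ℕ+, (1 - PowerSeries.X ^ (i : ℕ) : ℂ⟦X⟧) ^ (l - 1)) *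
      (∏' j : ℕ+, (1 - PowerSeries.X ^ (2 * (j : ℕ)) : ℂ⟦X⟧)) *
      (∏' r : {r : ℕ+ // (r : ℕ) ≡ l + 1 [MOD 2 * (l + 1)]},
        (1 - PowerSeries.X ^ (r.1 : ℕ) : ℂ⟦X⟧)) ∧
    -- the array for `(2, 1, …, 1)`
    (∀ m : ℕ, AffineC.multiplicity l (AffineC.seq21 l) m = if m = 0 then 0 else (l : ℕ∞)) ∧
    -- the denominator for `(2, 1, …, 1)`
    (∀ j : ℕ+, FiniteDimensional ℂ (AffineC.gradedPiece l (AffineC.seq21 l) (j : ℤ))) ∧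
    Multipliable (AffineC.denominatorFactor l (AffineC.seq21 l)) ∧
    Multipliable (fun i : ℕ+ => (1 - PowerSeries.X ^ (i : ℕ) : ℂ⟦X⟧) ^ l) ∧
    AffineC.Q l (AffineC.seq21 l) = ∏' i : ℕ+, (1 - PowerSeries.X ^ (i : ℕ) : ℂ⟦X⟧) ^ l := by
  have h212 : AffineC.denominatorFactor l (AffineC.seq212 l) = fun j : ℕ+ =>
      (1 - PowerSeries.X ^ (j : ℕ) : ℂ⟦X⟧) ^ (l - 1) *
        (1 - PowerSeries.X ^ (j : ℕ)) ^ (if Even (j : ℕ) then 1 else 0) *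
        (1 - PowerSeries.X ^ (j : ℕ)) ^
          (if (j : ℕ) ≡ l + 1 [MOD 2 * (l + 1)] then 1 else 0) := by
    funext j
    rw [AffineC.denominatorFactor, (AffineC.gradedPiece_seq212 hl j).2, pow_add, pow_add]
  have h21 : AffineC.denominatorFactor l (AffineC.seq21 l) = fun j : ℕ+ =>
      (1 - PowerSeries.X ^ (j : ℕ) : ℂ⟦X⟧) ^ l := by
    funext j
    rw [AffineC.denominatorFactor, (AffineC.gradedPiece_seq21 hl j).2]
  refine ⟨AffineC.multiplicity_seq212 hl, fun j => (AffineC.gradedPiece_seq212 hl j).1,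
    PowerSeries.multipliable_one_sub_X_pow_pow _, PowerSeries.multipliable_one_sub_X_pow_pow _,
    PowerSeries.multipliable_one_sub_X_pow_two_mul,
    PowerSeries.multipliable_one_sub_X_pow_subtype _, ?_, AffineC.multiplicity_seq21 hl,
    fun j => (AffineC.gradedPiece_seq21 hl j).1, PowerSeries.multipliable_one_sub_X_pow_pow _,
    PowerSeries.multipliable_one_sub_X_pow_pow _, ?_⟩
  · rw [AffineC.Q, h212, PowerSeries.tprod_one_sub_X_pow_two_mul,
      PowerSeries.tprod_one_sub_X_pow_subtype, ← Multipliable.tprod_mul, ← Multipliable.tprod_mul]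
    · exact (PowerSeries.multipliable_one_sub_X_pow_pow _).mul
        (PowerSeries.multipliable_one_sub_X_pow_pow _)
    all_goals exact PowerSeries.multipliable_one_sub_X_pow_pow _
  · rw [AffineC.Q, h21]
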